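/- Let $\mathbb{T}^1=\mathbb{R}/\mathbb{Z}$, let $\Theta$ be a compact metric space and let $r:\Theta\to\Theta$ be a continuous map with exactly one $r$-invariant Borel probability measure. Let $f:\Theta\times\mathbb{T}^1\to\Theta\times\mathbb{T}^1$ be a continuous map of the form $f(\theta,\varphi)=(r(\theta),f_\theta(\varphi))$ that is homotopic to $(\theta,\varphi)\mapsto(r(\theta),\varphi)$. Let $\pi:\Theta\times\mathbb{R}\to\Theta\times\mathbb{T}^1$ be the natural projection and let $F:\Theta\times\mathbb{R}\to\Theta\times\mathbb{R}$, $F(\theta,x)=(r(\theta),F_\theta(x))$, be a continuous lift of $f$, that is, $\pi\circ F=f\circ\pi$. Write $F^n_\theta=F_{r^{n-1}(\theta)}\circ\dots\circ F_\theta$ and $$\rho_{\mathrm{fib}}(F)=\Big\{\limsup_{n\to\infty}\tfrac1n\big(F^n_\theta(x)-x\big)\ :\ (\theta,x)\in\Theta\times\mathbb{R}\Big\}.$$ Then $\rho_{\mathrm{fib}}(F)$ is a nonempty compact interval $[a,b]$, $a\le b$ (possibly a single point). Moreover, for every $\rho\in\rho_{\mathrm{fib}}(F)$ there is a minimal set $M_\rho\subseteq\Theta\times\mathbb{T}^1$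 of $f$ (a nonempty closed set with $f(M_\rho)\subseteq M_\rho$ that has no proper nonempty closed subset $N$ with $f(N)\subseteq N$) such that (i) $\frac1n(F^n_\theta(x)-x)$ converges to $\rho$ as $n\to\infty$, uniformly in $(\theta,x)\in\pi^{-1}(M_\rho)$; (ii) if $h_{\mathrm{top}}(r)=0$ (as is the case, for instance, for an irrational rotation $r$ of $\Theta=\mathbb{T}^1$), then $h_{\mathrm{top}}(f|_{M_\rho})=0$, where $h_{\mathrm{top}}$ denotes topological entropy. -/

import Mathlib

open Filter Topology MeasureTheory

noncomputable section

/-- `r` has exactly one invariant Borel probability measure. -/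
def IsUniquelyErgodic {Θ : Type*} [MeasurableSpace Θ] (r : Θ → Θ) : Prop :=
  ∃! μ : Measure Θ, IsProbabilityMeasure μ ∧ MeasurePreserving r μ μ

/-- The natural projection `Θ × ℝ → Θ × ℝ/ℤ`. -/
def circleProj (Θ : Type*) (p : Θ × ℝ) : Θ × UnitAddCircle :=
  (p.1, (p.2 : UnitAddCircle))

/-- `f (θ, φ) = (r θ, f_θ φ)`: `f` is a skew product over `r`. -/
def IsSkewProductOver {Θ : Type*} (r : Θ → Θ) (f : Θ × UnitAddCircle → Θ × UnitAddCircle) : Prop :=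
  ∀ p, (f p).1 = r p.1

/-- A skew product `f` over `r` is called homotopic to the identity if it is homotopic to
`(θ, φ) ↦ (r θ, φ)`. -/
def IsHomotopicToId {Θ : Type*} [TopologicalSpace Θ] (r : C(Θ, Θ))
    (f : C(Θ × UnitAddCircle, Θ × UnitAddCircle)) : Prop :=
  ContinuousMap.Homotopic f (r.prodMap (ContinuousMap.id UnitAddCircle))

/-- `F` is a (continuous) lift of `f` to `Θ × ℝ`. -/
def IsLift {Θ : Type*} [TopologicalSpace Θ] (F : C(Θ × ℝ, Θ × ℝ))
    (f : C(Θ × UnitAddCircle, Θ × UnitAddCircle)) : Prop :=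
  ∀ p, circleProj Θ (F p) = f (circleProj Θ p)

/-- The quotient `(F^n_θ(x) - x) / n` at `p = (θ, x)`. For `F (θ, x) = (r θ, F_θ x)`, the second
coordinate of the `n`-th iterate of `F` at `(θ, x)` is
`F^n_θ(x) = (F_{r^{n-1} θ} ∘ ⋯ ∘ F_θ) (x)`. -/
def rotationQuotient {Θ : Type*} (F : Θ × ℝ → Θ × ℝ) (n : ℕ) (p : Θ × ℝ) : ℝ :=
  ((F^[n] p).2 - p.2) / n

/-- The fibred rotation set of a lift `F`. -/
def fibredRotationSet {Θ : Type*} (F : Θ × ℝ → Θ × ℝ) : Set ℝ :=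
  Set.range fun p : Θ × ℝ => limsup (fun n : ℕ => rotationQuotient F n p) atTop

/-- Minimal sets: nonempty closed invariant sets without proper nonempty closed invariant
subsets. -/
structure IsMinimalSet {X : Type*} [TopologicalSpace X] (f : X → X) (M : Set X) : Prop where
  isClosed : IsClosed M
  nonempty : M.Nonempty
  mapsTo : Set.MapsTo f M M
  eq_of_subset : ∀ N : Set X, N ⊆ M → IsClosed N → N.Nonempty → Set.MapsTo f N N → N = M

/-- Topological entropy of a self-map (Bowen's definition by covers with dynamical balls). -/
def topEntropy {X : Type*} [UniformSpace X] (T : X → X) : EReal :=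
  Dynamics.coverEntropy T Set.univ

end

/-!
Replace the fibre maps `x ↦ G (θ, x)` of the lift by the monotone maps
`T_t = truncatedEnvelope G t`, which increase continuously from the largest monotone map below `G`
at `t = 0` to a monotone map above `G` for large `t`. A monotone degree one skew product over a
uniquely ergodic base has almost additive displacements, so its rotation quotients converge
uniformly to a number `ρ(t)`, and `ρ` is continuous. Monotone comparison squeezes every upper limit
for `G` between `ρ(0)` and `ρ(t₁)`, and the intermediate value theorem exhausts this interval.

Conversely `G` and `T_t` agree along entire orbits over some compact invariant set: in each fibre
every value is attained by both at a common point, so agreeing orbit segments can be built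
backwards from their last point. On a minimal set inside it `f` is the circle map induced by `T_t`.
Monotone fibre maps add no entropy: in a grid of mesh `1 / N` the itineraries of length `m` in one
fibre take at most `m * N + 1` values, and `log (m * N + 1) / m → 0`.
-/

open BoundedContinuousFunction

theorem sub_eq_sub_of_coe_unitAddCircle_eq {X : Type*} [TopologicalSpace X] [PreconnectedSpace X]
    {u v : X → ℝ} (hu : Continuous u) (hv : Continuous v)
    (h : ∀ x, (u x : UnitAddCircle) = v x) (x y : X) : u x - v x = u y - v y := by
  have hcoe : ∀ x, ((u x - v x : ℝ) : UnitAddCircle) = 0 := fun x => by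
    rw [AddCircle.coe_sub, h x, sub_self]
  exact (AddCircle.isCoveringMap_coe (1 : ℝ)).const_of_comp (hu.sub hv)
    (fun a b => (hcoe a).trans (hcoe b).symm) x y

/-- Homotopic circle maps have the same degree. -/
theorem lift_add_one_sub_eq_of_homotopic {u v : C(UnitAddCircle, UnitAddCircle)}
    (huv : u.Homotopic v) {U V : ℝ → ℝ} (hU : Continuous U) (hV : Continuous V)
    (hUu : ∀ x : ℝ, (U x : UnitAddCircle) = u x) (hVv : ∀ x : ℝ, (V x : UnitAddCircle) = v x)
    (x : ℝ) : U (x + 1) - U x = V (x + 1) - V x := by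
  obtain ⟨h⟩ := huv
  have hcov := AddCircle.isCoveringMap_coe (1 : ℝ)
  let H : C(unitInterval × ℝ, UnitAddCircle) :=
    ⟨fun q => h (q.1, (q.2 : UnitAddCircle)), by have := hcov.continuous; fun_prop⟩
  have H_zero : ∀ a, H (0, a) = (⟨U, hU⟩ : C(ℝ, ℝ)) a := fun a => by simp [H, hUu]
  let L := hcov.liftHomotopy H ⟨U, hU⟩ H_zero
  have coe_L : ∀ q, (L q : UnitAddCircle) = H q :=
    congrFun (hcov.liftHomotopy_lifts H ⟨U, hU⟩ H_zero)
  have L_zero : ∀ a, L (0, a) = U a := hcov.liftHomotopy_zero H ⟨U, hU⟩ H_zero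
  have const_in_time : L (0, x + 1) - L (0, x) = L (1, x + 1) - L (1, x) :=
    sub_eq_sub_of_coe_unitAddCircle_eq (u := fun t => L (t, x + 1)) (v := fun t => L (t, x))
      (by fun_prop) (by fun_prop) (fun t => by simp [coe_L, H]) 0 1
  have const_in_space : L (1, x + 1) - V (x + 1) = L (1, x) - V x :=
    sub_eq_sub_of_coe_unitAddCircle_eq (u := fun y => L (1, y)) (by fun_prop) hV
      (fun y => by simp [coe_L, H, hVv]) (x + 1) x
  rw [L_zero, L_zero] at const_in_time
  linarith

section

variable {Θ : Type*} [TopologicalSpace Θ] {r : C(Θ, Θ)}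
  {f : C(Θ × UnitAddCircle, Θ × UnitAddCircle)} {F : C(Θ × ℝ, Θ × ℝ)}

theorem IsLift.fst_apply (hF : IsLift F f) (hf : IsSkewProductOver r f) (p : Θ × ℝ) :
    (F p).1 = r p.1 :=
  (congrArg Prod.fst (hF p)).trans (hf _)

theorem IsLift.snd_apply_add_one (hF : IsLift F f) (hhom : IsHomotopicToId r f) (θ : Θ) (x : ℝ) :
    (F (θ, x + 1)).2 = (F (θ, x)).2 + 1 := by
  let fibreMap (g : C(Θ × UnitAddCircle, Θ × UnitAddCircle)) : C(UnitAddCircle, UnitAddCircle) :=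
    ContinuousMap.snd.comp (g.comp (.prodMk (.const _ θ) (.id _)))
  have hom_id : (fibreMap f).Homotopic (fibreMap (r.prodMap (.id _))) :=
    .comp (.refl _) (.comp hhom (.refl _))
  have := lift_add_one_sub_eq_of_homotopic hom_id (U := fun y => (F (θ, y)).2) (V := fun y => y)
    (by fun_prop) continuous_id (fun y => congrArg Prod.snd (hF (θ, y))) (fun y => rfl) x
  linarith

end

/-- The uniform probability measure on the orbit segment `x, T x, …, T^[n] x`. It is indexed so
that the segment is never empty. -/
noncomputable def empiricalMeasure {X : Type*} [MeasurableSpace X] (T : X → X) (n : ℕ) (x : X) :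
    ProbabilityMeasure X :=
  ⟨((n + 1 : ℕ) : ENNReal)⁻¹ • ∑ k ∈ Finset.range (n + 1), Measure.dirac (T^[k] x), ⟨by
    simp only [Measure.smul_apply, Measure.finsetSum_apply, measure_univ, Finset.sum_const,
      Finset.card_range, smul_eq_mul, nsmul_eq_mul, mul_one]
    exact ENNReal.inv_mul_cancel (by simp) (by simp)⟩⟩

section UniquelyErgodic

variable {X ι : Type*} [TopologicalSpace X] {T : X → X} {n : ι → ℕ} {x : ι → X} {l : Filter ι}

theorem tendsto_birkhoffAverage_apply_sub (g : X →ᵇ ℝ) (hn : Tendsto n l atTop) :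
    Tendsto (fun i => birkhoffAverage ℝ T g (n i) (T (x i)) - birkhoffAverage ℝ T g (n i) (x i))
      l (𝓝 0) := by
  have hbound : Tendsto (fun i => 2 * ‖g‖ / n i) l (𝓝 0) :=
    (tendsto_const_div_atTop_nhds_zero_nat _).comp hn
  refine squeeze_zero_norm (fun i => ?_) hbound
  rw [← dist_eq_norm, dist_birkhoffAverage_apply_birkhoffAverage]
  gcongr
  exact g.dist_le_two_norm _ _

variable [MeasurableSpace X]

theorem integral_empiricalMeasure [OpensMeasurableSpace X] (T : X → X) (n : ℕ) (x : X)
    (g : X →ᵇ ℝ) :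
    ∫ y, g y ∂(empiricalMeasure T n x : Measure X) = birkhoffAverage ℝ T g (n + 1) x := by
  rw [empiricalMeasure, ProbabilityMeasure.coe_mk, integral_smul_measure,
    integral_finsetSum_measure fun k _ => g.integrable _]
  simp only [integral_dirac' _ _ g.continuous.stronglyMeasurable, ENNReal.toReal_inv,
    ENNReal.toReal_natCast, birkhoffAverage, birkhoffSum]

variable [HasOuterApproxClosed X] [BorelSpace X]

theorem measurePreserving_of_tendsto_empiricalMeasure [l.NeBot] (hT : Continuous T)
    (hn : Tendsto n l atTop) {ν : ProbabilityMeasure X}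
    (hν : Tendsto (fun i => empiricalMeasure T (n i) (x i)) l (𝓝 ν)) :
    MeasurePreserving T (ν : Measure X) ν := by
  have hlim (g : X →ᵇ ℝ) : Tendsto (fun i => birkhoffAverage ℝ T g (n i + 1) (x i)) l
      (𝓝 (∫ y, g y ∂(ν : Measure X))) := by
    simpa only [integral_empiricalMeasure] using
      ProbabilityMeasure.tendsto_iff_forall_integral_tendsto.1 hν g
  refine ⟨hT.measurable, ?_⟩
  have := Measure.isProbabilityMeasure_map (μ := (ν : Measure X)) hT.aemeasurable
  refine ext_of_forall_integral_eq_of_IsFiniteMeasure fun g => ?_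
  rw [integral_map hT.aemeasurable g.continuous.aestronglyMeasurable]
  have hcomp := hlim (g.compContinuous ⟨T, hT⟩)
  have hshift := (tendsto_birkhoffAverage_apply_sub (T := T) (x := x) g
    ((tendsto_add_atTop_nat 1).comp hn)).add (hlim g)
  simp only [Function.comp_apply, sub_add_cancel, zero_add] at hshift
  refine tendsto_nhds_unique (hcomp.congr fun i => ?_) hshift
  simp only [birkhoffAverage, birkhoffSum, compContinuous_apply, ContinuousMap.coe_mk,
    ← Function.iterate_succ_apply, ← Function.iterate_succ_apply']

variable [CompactSpace X] [T2Space X] {μ : Measure X} {g : X → ℝ}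

theorem tendsto_birkhoffAverage_of_uniquelyErgodic (hT : Continuous T)
    (hμ : ∀ ν : Measure X, IsProbabilityMeasure ν → MeasurePreserving T ν ν → ν = μ)
    (hg : Continuous g) (hn : Tendsto n l atTop) :
    Tendsto (fun i => birkhoffAverage ℝ T g (n i) (x i)) l (𝓝 (∫ y, g y ∂μ)) := by
  rw [tendsto_iff_ultrafilter]
  intro 𝒰 h𝒰
  have hn𝒰 : Tendsto n 𝒰 atTop := hn.mono_left h𝒰
  obtain ⟨ν, -, hν⟩ := isCompact_univ.ultrafilter_le_nhds
    (𝒰.map fun i => empiricalMeasure T (n i - 1) (x i)) (by simp)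
  have hinv := measurePreserving_of_tendsto_empiricalMeasure hT
    ((tendsto_sub_atTop_nat 1).comp hn𝒰) hν
  rw [← hμ ν inferInstance hinv]
  refine (ProbabilityMeasure.tendsto_iff_forall_integral_tendsto.1 hν
    (mkOfCompact ⟨g, hg⟩)).congr' ?_
  filter_upwards [hn𝒰.eventually_ge_atTop 1] with i hi
  rw [integral_empiricalMeasure, Nat.sub_add_cancel hi]
  rfl

theorem tendstoUniformly_birkhoffAverage_of_uniquelyErgodic (hT : Continuous T)
    (hμ : ∀ ν : Measure X, IsProbabilityMeasure ν → MeasurePreserving T ν ν → ν = μ)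
    (hg : Continuous g) :
    TendstoUniformly (birkhoffAverage ℝ T g) (fun _ => ∫ y, g y ∂μ) atTop := by
  rw [tendstoUniformly_iff_tendsto]
  exact tendsto_left_nhds_uniformity.comp
    (tendsto_birkhoffAverage_of_uniquelyErgodic hT hμ hg tendsto_fst)

end UniquelyErgodic

section AlmostAdditive

theorem sum_range_add_sub_comm {E : Type*} [AddCommGroup E] (D : ℕ → E) (m n : ℕ) :
    ∑ k ∈ Finset.range n, (D (k + m) - D k) = ∑ j ∈ Finset.range m, (D (j + n) - D j) := by
  have h := Finset.sum_range_add D n m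
  rw [add_comm n m, Finset.sum_range_add D m n] at h
  simp only [Finset.sum_sub_distrib, add_comm _ m, add_comm _ n, sub_eq_sub_iff_add_eq_add,
    add_comm _ (∑ k ∈ Finset.range m, D k), h]
  rw [add_comm]

/-- `a` is an additive cocycle over `T` up to an error of at most `K`. -/
def IsAlmostAdditive {X : Type*} (T : X → X) (a : ℕ → X → ℝ) (K : ℝ) : Prop :=
  ∀ m n x, |a (m + n) x - a m x - a n (T^[m] x)| ≤ K

namespace IsAlmostAdditive

variable {X : Type*} {T : X → X} {a : ℕ → X → ℝ} {K : ℝ}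

/-- Both terms on the left are close to `∑ k < n, (a (k + m) x - a k x)`. -/
theorem abs_mul_sub_birkhoffSum_le (ha : IsAlmostAdditive T a K) (m n : ℕ) (x : X) :
    |m * a n x - birkhoffSum T (a m) n x| ≤
      ∑ j ∈ Finset.range m, (K + |a j x| + |a j (T^[n] x)|) + n * K := by
  have close_to_mul : |m * a n x - ∑ j ∈ Finset.range m, (a (j + n) x - a j x)| ≤
      ∑ j ∈ Finset.range m, (K + |a j x| + |a j (T^[n] x)|) := by
    rw [show m * a n x = ∑ _j ∈ Finset.range m, a n x by simp, ← Finset.sum_sub_distrib]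
    refine (Finset.abs_sum_le_sum_abs _ _).trans (Finset.sum_le_sum fun j _ => ?_)
    rw [add_comm j n]
    have := ha n j x
    grind
  have close_to_birkhoffSum :
      |∑ k ∈ Finset.range n, (a (k + m) x - a k x) - birkhoffSum T (a m) n x| ≤ n * K := by
    rw [birkhoffSum, ← Finset.sum_sub_distrib]
    refine (Finset.abs_sum_le_sum_abs _ _).trans ?_
    simpa using Finset.sum_le_sum fun k (_ : k ∈ Finset.range n) => ha k m x
  rw [← sum_range_add_sub_comm (a · x) m n] at close_to_mul
  exact (abs_sub_le _ _ _).trans (add_le_add close_to_mul close_to_birkhoffSum)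

variable [TopologicalSpace X] [CompactSpace X]

theorem exists_abs_mul_sub_birkhoffSum_le (ha : IsAlmostAdditive T a K)
    (hcont : ∀ n, Continuous (a n)) (m : ℕ) :
    ∃ C, ∀ n x, |m * a n x - birkhoffSum T (a m) n x| ≤ C + n * K := by
  have hbound (j : ℕ) : ∃ C, ∀ x, |a j x| ≤ C := by
    simpa using isCompact_univ.exists_bound_of_continuousOn (hcont j).continuousOn
  choose C hC using hbound
  refine ⟨∑ j ∈ Finset.range m, (K + C j + C j), fun n x =>
    (ha.abs_mul_sub_birkhoffSum_le m n x).trans ?_⟩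
  gcongr <;> exact hC _ _

variable [T2Space X] [HasOuterApproxClosed X] [MeasurableSpace X] [BorelSpace X] {μ : Measure X}

theorem eventually_abs_div_sub_integral_div_le (ha : IsAlmostAdditive T a K)
    (hcont : ∀ n, Continuous (a n)) (hT : Continuous T)
    (hμ : ∀ ν : Measure X, IsProbabilityMeasure ν → MeasurePreserving T ν ν → ν = μ)
    {m : ℕ} (hm : 0 < m) :
    ∀ᶠ n : ℕ in atTop, ∀ x, |a n x / n - (∫ y, a m y ∂μ) / m| ≤ (K + 2) / m := by
  obtain ⟨C, hC⟩ := ha.exists_abs_mul_sub_birkhoffSum_le hcont m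
  have hbirkhoff := Metric.tendstoUniformly_iff.1
    (tendstoUniformly_birkhoffAverage_of_uniquelyErgodic hT hμ (hcont m)) 1 one_pos
  filter_upwards [hbirkhoff, eventually_gt_atTop 0,
    tendsto_natCast_atTop_atTop.eventually_ge_atTop C] with n hn hn0 hnC x
  have hm' : (0 : ℝ) < m := by exact_mod_cast hm
  have hn' : (0 : ℝ) < n := by exact_mod_cast hn0
  have h_mul : |m * a n x / n - birkhoffAverage ℝ T (a m) n x| ≤ K + 1 := by
    rw [birkhoffAverage, smul_eq_mul, inv_mul_eq_div, ← sub_div, abs_div, abs_of_pos hn',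
      div_le_iff₀ hn']
    linarith [hC n x]
  have h_avg := (hn x).le
  rw [dist_comm, Real.dist_eq] at h_avg
  have h_split : a n x / n - (∫ y, a m y ∂μ) / m = (m * a n x / n - ∫ y, a m y ∂μ) / m := by
    field_simp
  rw [h_split, abs_div, abs_of_pos hm']
  gcongr
  linarith [abs_sub_le (m * a n x / n) (birkhoffAverage ℝ T (a m) n x) (∫ y, a m y ∂μ)]

end IsAlmostAdditive

theorem exists_tendstoUniformly_of_forall_eventually_dist_le {X E : Type*} [Nonempty X]
    [PseudoMetricSpace E] [CompleteSpace E] {u : ℕ → X → E} {J : ℕ → E} {δ : ℕ → ℝ}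
    (hδ : Tendsto δ atTop (𝓝 0))
    (h : ∀ m, 0 < m → ∀ᶠ n in atTop, ∀ x, dist (u n x) (J m) ≤ δ m) :
    ∃ ρ, TendstoUniformly u (fun _ => ρ) atTop ∧ ∀ m, 0 < m → dist ρ (J m) ≤ δ m := by
  obtain ⟨x₀⟩ := ‹Nonempty X›
  have small {ε : ℝ} (hε : 0 < ε) : ∃ m, 0 < m ∧ δ m < ε / 2 :=
    ((eventually_gt_atTop 0).and (hδ.eventually_lt_const (half_pos hε))).exists
  have hcauchy : CauchySeq fun n => u n x₀ := by
    refine Metric.cauchySeq_iff'.2 fun ε hε => ?_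
    obtain ⟨m, hm, hδm⟩ := small hε
    obtain ⟨N, hN⟩ := eventually_atTop.1 (h m hm)
    refine ⟨N, fun n hn => ?_⟩
    linarith [hN n hn x₀, hN N le_rfl x₀, dist_triangle_right (u n x₀) (u N x₀) (J m)]
  obtain ⟨ρ, hρ⟩ := cauchySeq_tendsto_of_complete hcauchy
  have hρJ (m : ℕ) (hm : 0 < m) : dist ρ (J m) ≤ δ m :=
    le_of_tendsto (hρ.dist tendsto_const_nhds) ((h m hm).mono fun n hn => hn x₀)
  refine ⟨ρ, Metric.tendstoUniformly_iff.2 fun ε hε => ?_, hρJ⟩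
  obtain ⟨m, hm, hδm⟩ := small hε
  filter_upwards [h m hm] with n hn x
  linarith [hn x, hρJ m hm, dist_triangle_right ρ (u n x) (J m)]

end AlmostAdditive

/-- The skew product over `r` with fibre coordinate `G`. -/
def skewProduct {Θ : Type*} (r : Θ → Θ) (G : Θ × ℝ → ℝ) (p : Θ × ℝ) : Θ × ℝ :=
  (r p.1, G p)

/-- `G` is the fibre coordinate of a lift of a skew product whose fibre maps have degree one. -/
structure IsDegreeOneLift {Θ : Type*} [TopologicalSpace Θ] (G : Θ × ℝ → ℝ) : Prop where
  continuous : Continuous G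
  apply_add_one : ∀ θ x, G (θ, x + 1) = G (θ, x) + 1

/-- A degree one lift that is nondecreasing on fibres. -/
structure IsMonotoneLift {Θ : Type*} [TopologicalSpace Θ] (G : Θ × ℝ → ℝ) : Prop extends
    IsDegreeOneLift G where
  monotone : ∀ θ, Monotone fun x => G (θ, x)

section SkewProduct

variable {Θ : Type*} {r : Θ → Θ} {G H : Θ × ℝ → ℝ}

theorem skewProduct_iterate_fst (r : Θ → Θ) (G : Θ × ℝ → ℝ) (n : ℕ) (p : Θ × ℝ) :
    ((skewProduct r G)^[n] p).1 = r^[n] p.1 :=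
  (Function.Semiconj.iterate_right (fun _ => rfl : Function.Semiconj Prod.fst _ r) n) p

theorem skewProduct_iterate_eq_mk (r : Θ → Θ) (G : Θ × ℝ → ℝ) (n : ℕ) (p : Θ × ℝ) :
    (skewProduct r G)^[n] p = (r^[n] p.1, ((skewProduct r G)^[n] p).2) :=
  Prod.ext (skewProduct_iterate_fst r G n p) rfl

theorem skewProduct_iterate_succ_snd (r : Θ → Θ) (G : Θ × ℝ → ℝ) (n : ℕ) (p : Θ × ℝ) :
    ((skewProduct r G)^[n + 1] p).2 = G (r^[n] p.1, ((skewProduct r G)^[n] p).2) := by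
  rw [Function.iterate_succ_apply', ← skewProduct_iterate_eq_mk]
  rfl

variable [TopologicalSpace Θ]

theorem continuous_skewProduct_iterate {A : Type*} [TopologicalSpace A] {H : A → Θ × ℝ → ℝ}
    (hr : Continuous r) (hH : Continuous fun q : A × (Θ × ℝ) => H q.1 q.2) (n : ℕ) :
    Continuous fun q : A × (Θ × ℝ) => (skewProduct r (H q.1))^[n] q.2 := by
  induction n with
  | zero => exact continuous_snd
  | succ n ih =>
    simp only [Function.iterate_succ_apply']
    exact (hr.comp (continuous_fst.comp ih)).prodMk (hH.comp (continuous_fst.prodMk ih))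

namespace IsDegreeOneLift

theorem continuous_fibre (hG : IsDegreeOneLift G) (θ : Θ) : Continuous fun x => G (θ, x) :=
  hG.continuous.comp (Continuous.prodMk_right θ)

theorem apply_add_int (hG : IsDegreeOneLift G) (θ : Θ) (x : ℝ) (k : ℤ) :
    G (θ, x + k) = G (θ, x) + k :=
  AddConstMapClass.map_add_int (⟨fun x => G (θ, x), hG.apply_add_one θ⟩ : AddConstMap ℝ ℝ 1 1) x k

theorem apply_fract_sub_fract (hG : IsDegreeOneLift G) (θ : Θ) (x : ℝ) :
    G (θ, Int.fract x) - Int.fract x = G (θ, x) - x := by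
  have h := hG.apply_add_int θ (Int.fract x) ⌊x⌋
  rw [Int.fract_add_floor] at h
  linarith [Int.fract_add_floor x]

end IsDegreeOneLift

namespace IsMonotoneLift

/-- The map induced on the fibre over `θ`. -/
def fibreMap (hG : IsMonotoneLift G) (θ : Θ) : CircleDeg1Lift where
  toFun x := G (θ, x)
  monotone' := hG.monotone θ
  map_add_one' := hG.apply_add_one θ

theorem surjective_fibre (hG : IsMonotoneLift G) (θ : Θ) :
    Function.Surjective fun x => G (θ, x) :=
  (hG.fibreMap θ).continuous_iff_surjective.1 (hG.continuous_fibre θ)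

theorem iterate (hG : IsMonotoneLift G) (hr : Continuous r) (n : ℕ) :
    IsMonotoneLift fun p => ((skewProduct r G)^[n] p).2 where
  continuous := continuous_snd.comp <| Continuous.iterate (f := skewProduct r G)
    ((hr.comp continuous_fst).prodMk hG.continuous) n
  apply_add_one θ x := by
    induction n with
    | zero => rfl
    | succ n ih => simp only [skewProduct_iterate_succ_snd, ih, hG.apply_add_one]
  monotone θ x y hxy := by
    induction n with
    | zero => exact hxy
    | succ n ih => simpa only [skewProduct_iterate_succ_snd] using hG.monotone _ ih

theorem abs_apply_sub_sub_apply_zero_le (hG : IsMonotoneLift G) (θ : Θ) (x : ℝ) :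
    |G (θ, x) - x - G (θ, 0)| ≤ 1 := by
  have h_le : G (θ, x) ≤ G (θ, 0) + ⌈x⌉ := (hG.fibreMap θ).map_le_of_map_zero x
  have h_ge : G (θ, 0) + ⌊x⌋ ≤ G (θ, x) := (hG.fibreMap θ).le_map_of_map_zero x
  rw [abs_le]
  constructor <;> linarith [Int.ceil_lt_add_one x, Int.sub_one_lt_floor x]

theorem skewProduct_iterate_snd_le (hH : IsMonotoneLift H) (hGH : ∀ p, G p ≤ H p) (n : ℕ)
    (p : Θ × ℝ) : ((skewProduct r G)^[n] p).2 ≤ ((skewProduct r H)^[n] p).2 := by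
  induction n with
  | zero => exact le_rfl
  | succ n ih =>
    simp only [skewProduct_iterate_succ_snd]
    exact (hGH _).trans (hH.monotone _ ih)

theorem le_skewProduct_iterate_snd (hG : IsMonotoneLift G) (hGH : ∀ p, G p ≤ H p) (n : ℕ)
    (p : Θ × ℝ) : ((skewProduct r G)^[n] p).2 ≤ ((skewProduct r H)^[n] p).2 := by
  induction n with
  | zero => exact le_rfl
  | succ n ih =>
    simp only [skewProduct_iterate_succ_snd]
    exact (hG.monotone _ ih).trans (hGH _)

theorem isAlmostAdditive (hG : IsMonotoneLift G) (hr : Continuous r) :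
    IsAlmostAdditive r (fun n θ => ((skewProduct r G)^[n] (θ, 0)).2) 1 := fun m n θ => by
  have h := ((hG.iterate hr n).fibreMap (r^[m] θ)).dist_map_map_zero_lt
    ((hG.iterate hr m).fibreMap θ)
  simp only [fibreMap, CircleDeg1Lift.coe_mk, OrderHom.coe_mk, ← Function.iterate_add_apply,
    ← skewProduct_iterate_eq_mk r G m (θ, 0), add_comm n m] at h
  rw [dist_comm, Real.dist_eq] at h
  rw [sub_right_comm, ← sub_add_eq_sub_sub]
  exact h.le

end IsMonotoneLift

end SkewProduct

section RotationNumber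

variable {Θ : Type*} [TopologicalSpace Θ] [CompactSpace Θ] [T2Space Θ] [HasOuterApproxClosed Θ]
  [MeasurableSpace Θ] [BorelSpace Θ] {r : Θ → Θ} {μ : Measure Θ} [Nonempty Θ]

theorem IsMonotoneLift.exists_tendstoUniformly_rotationQuotient {G : Θ × ℝ → ℝ}
    (hG : IsMonotoneLift G) (hr : Continuous r)
    (hμ : ∀ ν : Measure Θ, IsProbabilityMeasure ν → MeasurePreserving r ν ν → ν = μ) :
    ∃ ρ : ℝ, TendstoUniformly (rotationQuotient (skewProduct r G)) (fun _ => ρ) atTop ∧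
      ∀ m : ℕ, 0 < m → dist ρ ((∫ θ, ((skewProduct r G)^[m] (θ, 0)).2 ∂μ) / m) ≤ 4 / m := by
  refine exists_tendstoUniformly_of_forall_eventually_dist_le
    (tendsto_const_div_atTop_nhds_zero_nat 4) fun m hm => ?_
  have hcont (n : ℕ) : Continuous fun θ => ((skewProduct r G)^[n] (θ, 0)).2 :=
    (hG.iterate hr n).continuous.comp (by fun_prop)
  filter_upwards [(hG.isAlmostAdditive hr).eventually_abs_div_sub_integral_div_le hcont hr hμ hm,
    eventually_ge_atTop m] with n hn hmn p
  have _ : (0 : ℝ) < m := by exact_mod_cast hm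
  have hmn' : (m : ℝ) ≤ n := by exact_mod_cast hmn
  have from_zero : |rotationQuotient (skewProduct r G) n p -
      ((skewProduct r G)^[n] (p.1, 0)).2 / n| ≤ 1 / m := by
    rw [rotationQuotient, ← sub_div, abs_div, Nat.abs_cast]
    gcongr
    exact (hG.iterate hr n).abs_apply_sub_sub_apply_zero_le p.1 p.2
  rw [Real.dist_eq]
  calc _ ≤ 1 / (m : ℝ) + (1 + 2) / m := (abs_sub_le _ _ _).trans (add_le_add from_zero (hn p.1))
    _ = (4 : ℝ) / m := by ring

/-- Continuity in the parameter holds because the rotation number is the uniform limit of the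
continuous functions `t ↦ ∫ Hᵐ_t(θ, 0) / m dμ`. -/
theorem exists_continuous_rotationNumber [IsFiniteMeasure μ]
    {A : Type*} [TopologicalSpace A] [FirstCountableTopology A] [LocallyCompactSpace A]
    {H : A → Θ × ℝ → ℝ} (hH : ∀ t, IsMonotoneLift (H t))
    (hcont : Continuous fun q : A × (Θ × ℝ) => H q.1 q.2) (hr : Continuous r)
    (hμ : ∀ ν : Measure Θ, IsProbabilityMeasure ν → MeasurePreserving r ν ν → ν = μ) :
    ∃ ρ : A → ℝ, Continuous ρ ∧
      ∀ t, TendstoUniformly (rotationQuotient (skewProduct r (H t))) (fun _ => ρ t) atTop := by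
  choose ρ hρ hρJ using fun t => (hH t).exists_tendstoUniformly_rotationQuotient hr hμ
  refine ⟨ρ, ?_, hρ⟩
  have hI (m : ℕ) :
      Continuous fun t => (∫ θ, ((skewProduct r (H t))^[m] (θ, 0)).2 ∂μ) / m := by
    refine Continuous.div_const ?_ _
    have := continuous_parametric_integral_of_continuous (μ := μ)
      (f := fun t θ => ((skewProduct r (H t))^[m] (θ, 0)).2)
      (continuous_snd.comp <| (continuous_skewProduct_iterate hr hcont m).comp
        (by fun_prop : Continuous fun q : A × Θ => (q.1, q.2, (0 : ℝ)))) isCompact_univ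
    simpa only [Measure.restrict_univ] using this
  refine TendstoUniformly.continuous (p := atTop) (Metric.tendstoUniformly_iff.2 fun ε hε => ?_)
    (Frequently.of_forall hI)
  filter_upwards [(tendsto_const_div_atTop_nhds_zero_nat 4).eventually_lt_const hε,
    eventually_gt_atTop 0] with m hm hm0 t
  exact (hρJ t m hm0).trans_lt hm

end RotationNumber

/-- The least fibrewise nondecreasing majorant `(θ, x) ↦ sup_{y ≤ x} G (θ, y)` of a degree one
lift. The supremum is taken over `[x - 1, x]`, which is enough by periodicity and makes it a
supremum over a compact set. -/
noncomputable def upperEnvelope {Θ : Type*} (G : Θ × ℝ → ℝ) (p : Θ × ℝ) : ℝ :=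
  sSup ((fun s => G (p.1, p.2 - s)) '' Set.Icc 0 1)

/-- Conjugation of the fibre maps by `x ↦ -x`, which exchanges upper and lower envelopes. -/
def fibreReflection {Θ : Type*} (G : Θ × ℝ → ℝ) (p : Θ × ℝ) : ℝ :=
  -G (p.1, -p.2)

/-- The greatest fibrewise nondecreasing minorant of a degree one lift. -/
noncomputable def lowerEnvelope {Θ : Type*} (G : Θ × ℝ → ℝ) : Θ × ℝ → ℝ :=
  fibreReflection (upperEnvelope (fibreReflection G))

/-- The monotone lift obtained by cutting `G` off at height `t` above its lower envelope and taking
the upper envelope. It interpolates between the two envelopes of `G`. -/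
noncomputable def truncatedEnvelope {Θ : Type*} (G : Θ × ℝ → ℝ) (t : ℝ) : Θ × ℝ → ℝ :=
  upperEnvelope fun p => min (G p) (lowerEnvelope G p + t)

section Envelope

variable {Θ : Type*} [TopologicalSpace Θ] {G : Θ × ℝ → ℝ}

theorem continuous_upperEnvelope {A : Type*} [TopologicalSpace A] {H : A → Θ × ℝ → ℝ}
    (hH : Continuous fun q : A × (Θ × ℝ) => H q.1 q.2) :
    Continuous fun q : A × (Θ × ℝ) => upperEnvelope (H q.1) q.2 :=
  isCompact_Icc.continuous_sSup (f := fun (q : A × (Θ × ℝ)) s => H q.1 (q.2.1, q.2.2 - s))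
    (hH.comp (by fun_prop :
      Continuous fun u : (A × (Θ × ℝ)) × ℝ => (u.1.1, (u.1.2.1, u.1.2.2 - u.2))))

theorem IsDegreeOneLift.fibreReflection (hG : IsDegreeOneLift G) :
    IsDegreeOneLift (fibreReflection G) where
  continuous := (hG.continuous.comp (by fun_prop : Continuous fun p : Θ × ℝ => (p.1, -p.2))).neg
  apply_add_one θ x := by
    have := hG.apply_add_one θ (-(x + 1))
    rw [neg_add, neg_add_cancel_right] at this
    simp only [_root_.fibreReflection, neg_add, this]
    ring

theorem IsMonotoneLift.fibreReflection (hG : IsMonotoneLift G) :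
    IsMonotoneLift (fibreReflection G) where
  toIsDegreeOneLift := hG.toIsDegreeOneLift.fibreReflection
  monotone θ _ _ hxy := neg_le_neg (hG.monotone θ (neg_le_neg hxy))

namespace IsDegreeOneLift

theorem isGreatest_upperEnvelope (hG : IsDegreeOneLift G) (θ : Θ) (x : ℝ) :
    IsGreatest ((fun y => G (θ, y)) '' Set.Iic x) (upperEnvelope G (θ, x)) := by
  have hgreatest : IsGreatest ((fun s => G (θ, x - s)) '' Set.Icc 0 1) (upperEnvelope G (θ, x)) :=
    (isCompact_Icc.image ((hG.continuous_fibre θ).comp (continuous_sub_left x))).isGreatest_sSup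
      ((Set.nonempty_Icc.2 zero_le_one).image _)
  refine ⟨?_, ?_⟩
  · obtain ⟨s, hs, hsU⟩ := hgreatest.1
    exact ⟨x - s, sub_le_self x hs.1, hsU⟩
  · rintro _ ⟨y, hyx, rfl⟩
    have hfract := hgreatest.2
      ⟨Int.fract (x - y), ⟨Int.fract_nonneg _, (Int.fract_lt_one _).le⟩, rfl⟩
    have hfloor : (0 : ℝ) ≤ ⌊x - y⌋ := by exact_mod_cast Int.floor_nonneg.2 (sub_nonneg.2 hyx)
    have hshift : x - Int.fract (x - y) = y + ⌊x - y⌋ := by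
      linarith [Int.fract_add_floor (x - y)]
    simp only [hshift, hG.apply_add_int] at hfract
    exact (le_add_of_nonneg_right hfloor).trans hfract

theorem le_upperEnvelope (hG : IsDegreeOneLift G) (θ : Θ) {x y : ℝ} (hyx : y ≤ x) :
    G (θ, y) ≤ upperEnvelope G (θ, x) :=
  (hG.isGreatest_upperEnvelope θ x).2 ⟨y, hyx, rfl⟩

theorem exists_apply_eq_upperEnvelope (hG : IsDegreeOneLift G) (θ : Θ) (x : ℝ) :
    ∃ y ≤ x, G (θ, y) = upperEnvelope G (θ, x) :=
  (hG.isGreatest_upperEnvelope θ x).1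

theorem isMonotoneLift_upperEnvelope (hG : IsDegreeOneLift G) :
    IsMonotoneLift (upperEnvelope G) where
  continuous := (continuous_upperEnvelope (A := Unit) (H := fun _ => G)
    (hG.continuous.comp continuous_snd)).comp (Continuous.prodMk_right ())
  apply_add_one θ x := by
    refine (hG.isGreatest_upperEnvelope θ (x + 1)).unique ⟨?_, ?_⟩
    · obtain ⟨y, hyx, hy⟩ := hG.exists_apply_eq_upperEnvelope θ x
      exact ⟨y + 1, add_le_add_left hyx 1, by simp only [hG.apply_add_one, hy]⟩
    · rintro _ ⟨y, hyx, rfl⟩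
      have hle := hG.le_upperEnvelope θ (sub_le_iff_le_add.2 hyx)
      have hy := hG.apply_add_one θ (y - 1)
      rw [sub_add_cancel] at hy
      linarith
  monotone θ x x' hxx' := (hG.isGreatest_upperEnvelope θ x).mono (hG.isGreatest_upperEnvelope θ x')
    (Set.image_mono (Set.Iic_subset_Iic.2 hxx'))

theorem isMonotoneLift_lowerEnvelope (hG : IsDegreeOneLift G) :
    IsMonotoneLift (lowerEnvelope G) :=
  hG.fibreReflection.isMonotoneLift_upperEnvelope.fibreReflection

theorem lowerEnvelope_le (hG : IsDegreeOneLift G) (θ : Θ) {x y : ℝ} (hxy : x ≤ y) :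
    lowerEnvelope G (θ, x) ≤ G (θ, y) := by
  have := hG.fibreReflection.le_upperEnvelope θ (neg_le_neg hxy)
  simp only [_root_.fibreReflection, neg_neg] at this
  exact neg_le.1 this

theorem exists_apply_eq_lowerEnvelope (hG : IsDegreeOneLift G) (θ : Θ) (x : ℝ) :
    ∃ y, x ≤ y ∧ G (θ, y) = lowerEnvelope G (θ, x) := by
  obtain ⟨y, hyx, hy⟩ := hG.fibreReflection.exists_apply_eq_upperEnvelope θ (-x)
  exact ⟨-y, le_neg_of_le_neg hyx, neg_eq_iff_eq_neg.1 hy⟩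

theorem exists_upperEnvelope_eq_and_apply_eq (hG : IsDegreeOneLift G) (θ : Θ) (y : ℝ) :
    ∃ x, upperEnvelope G (θ, x) = y ∧ G (θ, x) = y := by
  obtain ⟨z, rfl⟩ := hG.isMonotoneLift_upperEnvelope.surjective_fibre θ y
  obtain ⟨x, hxz, hx⟩ := hG.exists_apply_eq_upperEnvelope θ z
  exact ⟨x, (hG.isMonotoneLift_upperEnvelope.monotone θ hxz).antisymm
    (hx.ge.trans (hG.le_upperEnvelope θ le_rfl)), hx⟩

theorem min_lowerEnvelope_add (hG : IsDegreeOneLift G) (t : ℝ) :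
    IsDegreeOneLift fun p => min (G p) (lowerEnvelope G p + t) where
  continuous := hG.continuous.min (hG.isMonotoneLift_lowerEnvelope.continuous.add continuous_const)
  apply_add_one θ x := by
    rw [hG.apply_add_one, hG.isMonotoneLift_lowerEnvelope.apply_add_one, add_right_comm,
      min_add_add_right]

theorem isMonotoneLift_truncatedEnvelope (hG : IsDegreeOneLift G) (t : ℝ) :
    IsMonotoneLift (truncatedEnvelope G t) :=
  (hG.min_lowerEnvelope_add t).isMonotoneLift_upperEnvelope

theorem continuous_truncatedEnvelope (hG : IsDegreeOneLift G) :
    Continuous fun q : ℝ × (Θ × ℝ) => truncatedEnvelope G q.1 q.2 :=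
  continuous_upperEnvelope (H := fun t p => min (G p) (lowerEnvelope G p + t)) <|
    (hG.continuous.comp continuous_snd).min
      ((hG.isMonotoneLift_lowerEnvelope.continuous.comp continuous_snd).add continuous_fst)

theorem truncatedEnvelope_le_lowerEnvelope_add (hG : IsDegreeOneLift G) (t : ℝ) (p : Θ × ℝ) :
    truncatedEnvelope G t p ≤ lowerEnvelope G p + t := by
  obtain ⟨y, hy, hyT⟩ := (hG.min_lowerEnvelope_add t).exists_apply_eq_upperEnvelope p.1 p.2
  calc truncatedEnvelope G t p = min (G (p.1, y)) (lowerEnvelope G (p.1, y) + t) := hyT.symm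
    _ ≤ lowerEnvelope G (p.1, y) + t := min_le_right _ _
    _ ≤ lowerEnvelope G p + t :=
      add_le_add_left (hG.isMonotoneLift_lowerEnvelope.monotone p.1 hy) t

theorem truncatedEnvelope_zero_le (hG : IsDegreeOneLift G) (p : Θ × ℝ) :
    truncatedEnvelope G 0 p ≤ G p :=
  (hG.truncatedEnvelope_le_lowerEnvelope_add 0 p).trans
    (by simpa only [add_zero] using hG.lowerEnvelope_le p.1 le_rfl)

theorem exists_le_truncatedEnvelope [CompactSpace Θ] (hG : IsDegreeOneLift G) :
    ∃ t, 0 ≤ t ∧ ∀ p, G p ≤ truncatedEnvelope G t p := by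
  have hlow := hG.isMonotoneLift_lowerEnvelope
  obtain ⟨C, hC⟩ := (isCompact_univ.prod isCompact_Icc :
    IsCompact ((Set.univ : Set Θ) ×ˢ Set.Icc (0 : ℝ) 1)).exists_bound_of_continuousOn
    (hG.continuous.sub hlow.continuous).continuousOn
  refine ⟨|C|, abs_nonneg C, fun ⟨θ, x⟩ => ?_⟩
  refine (le_min le_rfl ?_).trans ((hG.min_lowerEnvelope_add _).le_upperEnvelope θ le_rfl)
  have hfract := hC (θ, Int.fract x) ⟨trivial, Int.fract_nonneg _, (Int.fract_lt_one _).le⟩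
  rw [Pi.sub_apply] at hfract
  linarith [hG.apply_fract_sub_fract θ x, hlow.apply_fract_sub_fract θ x, le_abs_self C,
    le_of_abs_le hfract]

theorem exists_truncatedEnvelope_eq_and_apply_eq (hG : IsDegreeOneLift G) {t : ℝ} (ht : 0 ≤ t)
    (θ : Θ) (y : ℝ) : ∃ x, truncatedEnvelope G t (θ, x) = y ∧ G (θ, x) = y := by
  obtain ⟨α, hTα, hα⟩ := (hG.min_lowerEnvelope_add t).exists_upperEnvelope_eq_and_apply_eq θ y
  rcases min_choice (G (θ, α)) (lowerEnvelope G (θ, α) + t) with hmin | hmin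
  · exact ⟨α, hTα, hmin.symm.trans hα⟩
  -- On `[α, β]` the envelope is constantly `y`, while `G` goes from at least `y` down to `y - t`.
  have hlow : lowerEnvelope G (θ, α) + t = y := hmin.symm.trans hα
  obtain ⟨β, hαβ, hβ⟩ := hG.exists_apply_eq_lowerEnvelope θ α
  obtain ⟨z, hz, hGz⟩ := intermediate_value_Icc' hαβ (hG.continuous_fibre θ).continuousOn
    (⟨by linarith, hα ▸ min_le_left _ _⟩ : y ∈ Set.Icc (G (θ, β)) (G (θ, α)))
  refine ⟨z, le_antisymm ?_ ?_, hGz⟩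
  · calc truncatedEnvelope G t (θ, z) ≤ lowerEnvelope G (θ, z) + t :=
          hG.truncatedEnvelope_le_lowerEnvelope_add t _
      _ ≤ G (θ, β) + t := by gcongr; exact hG.lowerEnvelope_le θ hz.2
      _ = y := by rw [hβ, hlow]
  · exact hTα.ge.trans ((hG.isMonotoneLift_truncatedEnvelope t).monotone θ hz.1)

end IsDegreeOneLift

end Envelope

section MinimalSet

variable {X : Type*} [TopologicalSpace X] [CompactSpace X] {f : X → X} {A : Set X}

theorem exists_isMinimalSet_subset (hA : IsClosed A) (hne : A.Nonempty) (hf : Set.MapsTo f A A) :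
    ∃ M ⊆ A, IsMinimalSet f M := by
  obtain ⟨M, hMA, hM⟩ := zorn_superset_nonempty
    {N : Set X | IsClosed N ∧ N.Nonempty ∧ Set.MapsTo f N N} (fun c hc hchain hcne => by
      refine ⟨⋂₀ c, ⟨isClosed_sInter fun s hs => (hc hs).1, ?_, fun x hx s hs =>
        (hc hs).2.2 (hx s hs)⟩, fun s hs => Set.sInter_subset_of_mem hs⟩
      have := hcne.to_subtype
      exact IsCompact.nonempty_sInter_of_directed_nonempty_isCompact_isClosed
        (IsChain.directedOn hchain.symm) (fun s hs => (hc hs).2.1)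
        (fun s hs => (hc hs).1.isCompact) fun s hs => (hc hs).1) A ⟨hA, hne, hf⟩
  exact ⟨M, hMA, hM.prop.1, hM.prop.2.1, hM.prop.2.2, fun N hNM hcl hNne hfN =>
    hNM.antisymm (hM.le_of_le ⟨hcl, hNne, hfN⟩ hNM)⟩

theorem exists_isMinimalSet_subset_of_forall_exists_iterate_mem (hf : Continuous f)
    (hA : IsClosed A) (hne : ∀ n, ∃ x, ∀ k ≤ n, f^[k] x ∈ A) : ∃ M ⊆ A, IsMinimalSet f M := by
  have hclosed (n : ℕ) : IsClosed {x | ∀ k ≤ n, f^[k] x ∈ A} := by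
    simp only [Set.ofPred_forall]
    exact isClosed_biInter fun k _ => hA.preimage (hf.iterate k)
  obtain ⟨x, hx⟩ := IsCompact.nonempty_iInter_of_sequence_nonempty_isCompact_isClosed
    (fun n => {x | ∀ k ≤ n, f^[k] x ∈ A}) (fun n x hx k hk => hx k (hk.trans n.le_succ)) hne
    (hclosed 0).isCompact hclosed
  have horbit : x ∈ ⋂ n, f^[n] ⁻¹' A := Set.mem_iInter.2 fun n => Set.mem_iInter.1 hx n n le_rfl
  obtain ⟨M, hMA, hM⟩ := exists_isMinimalSet_subset
    (isClosed_iInter fun n => hA.preimage (hf.iterate n)) ⟨x, horbit⟩ fun y hy =>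
      Set.mem_iInter.2 fun n => Set.mem_iInter.1 hy (n + 1)
  exact ⟨M, hMA.trans (Set.iInter_subset _ 0), hM⟩

end MinimalSet

section CircleProj

variable {Θ : Type*}

theorem exists_eq_add_int_of_circleProj_eq {p q : Θ × ℝ} (h : circleProj Θ p = circleProj Θ q) :
    ∃ k : ℤ, p = (q.1, q.2 + k) := by
  obtain ⟨hfst, hsnd⟩ := Prod.mk.inj h
  obtain ⟨k, hk⟩ := AddSubgroup.mem_zmultiples_iff.1 (QuotientAddGroup.eq_iff_sub_mem.1 hsnd)
  exact ⟨k, Prod.ext hfst (by rw [zsmul_one] at hk; simp only [hk, add_sub_cancel])⟩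

variable [TopologicalSpace Θ] {G H : Θ × ℝ → ℝ} {r : Θ → Θ}

theorem isOpenQuotientMap_circleProj (Θ : Type*) [TopologicalSpace Θ] :
    IsOpenQuotientMap (circleProj Θ) :=
  IsOpenQuotientMap.id.prodMap
    (QuotientAddGroup.isOpenQuotientMap_mk (N := AddSubgroup.zmultiples (1 : ℝ)))

theorem IsDegreeOneLift.exists_continuous_semiconj_circleProj (hG : IsDegreeOneLift G)
    (hr : Continuous r) :
    ∃ g, Continuous g ∧ Function.Semiconj (circleProj Θ) (skewProduct r G) g := by
  let π : C(Θ × ℝ, Θ × UnitAddCircle) := ⟨_, (isOpenQuotientMap_circleProj Θ).continuous⟩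
  let S : C(Θ × ℝ, Θ × ℝ) := ⟨skewProduct r G, (hr.comp continuous_fst).prodMk hG.continuous⟩
  have hπ : IsQuotientMap π := (isOpenQuotientMap_circleProj Θ).isQuotientMap
  have hfactors : Function.FactorsThrough (π.comp S) π := fun p q hpq => by
    obtain ⟨k, rfl⟩ := exists_eq_add_int_of_circleProj_eq hpq
    change circleProj Θ (skewProduct r G (q.1, q.2 + k)) = circleProj Θ (skewProduct r G q)
    simp [circleProj, skewProduct, hG.apply_add_int]
  exact ⟨hπ.lift _ hfactors, map_continuous _, fun p =>
    (DFunLike.congr_fun (hπ.lift_comp _ hfactors) p).symm⟩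

theorem IsDegreeOneLift.preimage_image_circleProj_setOf_eq (hG : IsDegreeOneLift G)
    (hH : IsDegreeOneLift H) :
    circleProj Θ ⁻¹' (circleProj Θ '' {p | G p = H p}) = {p | G p = H p} := by
  refine Set.Subset.antisymm ?_ (Set.subset_preimage_image _ _)
  rintro p ⟨q, hq, hqp⟩
  obtain ⟨k, rfl⟩ := exists_eq_add_int_of_circleProj_eq hqp.symm
  simpa only [Set.mem_ofPred_eq, hG.apply_add_int, hH.apply_add_int, add_left_inj] using hq

theorem IsDegreeOneLift.exists_forall_le_apply_eq_truncatedEnvelope (hG : IsDegreeOneLift G)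
    {t : ℝ} (ht : 0 ≤ t) (r : Θ → Θ) (n : ℕ) (θ : Θ) :
    ∃ x, ∀ k ≤ n, G ((skewProduct r G)^[k] (θ, x)) =
      truncatedEnvelope G t ((skewProduct r G)^[k] (θ, x)) := by
  induction n generalizing θ with
  | zero =>
    obtain ⟨x, hTx, hGx⟩ := hG.exists_truncatedEnvelope_eq_and_apply_eq ht θ 0
    exact ⟨x, fun k hk => by simp only [Nat.le_zero.1 hk, Function.iterate_zero, id, hTx, hGx]⟩
  | succ n ih =>
    obtain ⟨y, hy⟩ := ih (r θ)
    obtain ⟨x, hTx, hGx⟩ := hG.exists_truncatedEnvelope_eq_and_apply_eq ht θ y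
    refine ⟨x, fun k hk => ?_⟩
    rcases k with _ | k
    · exact hGx.trans hTx.symm
    · rw [Function.iterate_succ_apply, skewProduct, hGx]
      exact hy k (Nat.le_of_succ_le_succ hk)

variable [CompactSpace Θ] [Nonempty Θ] {f : Θ × UnitAddCircle → Θ × UnitAddCircle}

theorem IsDegreeOneLift.exists_isMinimalSet_eqOn_truncatedEnvelope (hG : IsDegreeOneLift G)
    (hf : Continuous f) (hfG : Function.Semiconj (circleProj Θ) (skewProduct r G) f) {t : ℝ}
    (ht : 0 ≤ t) :
    ∃ M, IsMinimalSet f M ∧ Set.EqOn G (truncatedEnvelope G t) (circleProj Θ ⁻¹' M) := by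
  have hT := hG.isMonotoneLift_truncatedEnvelope t
  have hpre := hG.preimage_image_circleProj_setOf_eq hT.toIsDegreeOneLift
  have hclosed : IsClosed (circleProj Θ '' {p | G p = truncatedEnvelope G t p}) := by
    rw [← (isOpenQuotientMap_circleProj Θ).isQuotientMap.isClosed_preimage, hpre]
    exact isClosed_eq hG.continuous hT.continuous
  obtain ⟨θ⟩ := ‹Nonempty Θ›
  have hsegment (n : ℕ) :
      ∃ q, ∀ k ≤ n, f^[k] q ∈ circleProj Θ '' {p | G p = truncatedEnvelope G t p} := by
    obtain ⟨x, hx⟩ := hG.exists_forall_le_apply_eq_truncatedEnvelope ht r n θ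
    exact ⟨circleProj Θ (θ, x), fun k hk => ⟨_, hx k hk, hfG.iterate_right k (θ, x)⟩⟩
  obtain ⟨M, hMA, hM⟩ :=
    exists_isMinimalSet_subset_of_forall_exists_iterate_mem hf hclosed hsegment
  exact ⟨M, hM, (Set.preimage_mono hMA).trans hpre.subset⟩

end CircleProj

section Coding

theorem dist_coe_unitAddCircle_le (x y : ℝ) : dist (x : UnitAddCircle) y ≤ |x - y| := by
  rw [dist_eq_norm, ← AddCircle.coe_sub, ← Real.norm_eq_abs]
  exact QuotientAddGroup.norm_mk_le_norm

theorem exists_fin_code_of_monotone {ι α : Type*} [Fintype ι] [LinearOrder α] {a : ι → α → ℤ}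
    (ha : ∀ i, Monotone (a i)) {l u : α} {K : ℕ} (hK : ∑ i, (a i u - a i l) ≤ K) :
    ∃ c : Set.Icc l u → Fin (K + 1), ∀ x y, c x = c y → ∀ i, a i x = a i y := by
  let s (x : α) : ℤ := ∑ i, (a i x - a i l)
  have hs_nonneg (x : Set.Icc l u) : 0 ≤ s x :=
    Finset.sum_nonneg fun i _ => sub_nonneg.2 (ha i x.2.1)
  have hs_le (x : Set.Icc l u) : s x ≤ K :=
    (Finset.sum_le_sum fun i _ => sub_le_sub_right (ha i x.2.2) _).trans hK
  refine ⟨fun x => ⟨(s x).toNat, by have := hs_le x; omega⟩, fun x y hxy => ?_⟩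
  have hs : s x = s y := by
    have htoNat : (s x).toNat = (s y).toNat := congrArg Fin.val hxy
    rw [← Int.toNat_of_nonneg (hs_nonneg x), htoNat, Int.toNat_of_nonneg (hs_nonneg y)]
  wlog hle : x ≤ y generalizing x y
  · exact fun i => (this y x hxy.symm hs.symm (le_of_not_ge hle) i).symm
  -- The increments from `x` to `y` are nonnegative and sum to zero, so each of them vanishes.
  have hterms := (Finset.sum_eq_sum_iff_of_le fun i _ => sub_le_sub_right (ha i hle) (a i l)).1 hs
  exact fun i => sub_left_injective (hterms i (Finset.mem_univ i))

variable {X Y : Type*} {T : X → X} {r : Y → Y} {φ : X → Y} {V : SetRel X X} {U : SetRel Y Y}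

theorem coverMincard_univ_le_card {ι : Type*} [Fintype ι] {n : ℕ} (c : X → ι)
    (hc : ∀ x y, c x = c y → (x, y) ∈ Dynamics.dynEntourage T V n) :
    Dynamics.coverMincard T Set.univ V n ≤ Fintype.card ι := by
  classical
  choose s hs using fun i : Set.range c => i.2
  have hcover : Dynamics.IsDynCoverOf T Set.univ V n (Finset.univ.image s : Finset X) :=
    fun x _ => ⟨s ⟨c x, x, rfl⟩, by simp, hc _ _ (hs ⟨c x, x, rfl⟩).symm⟩
  refine hcover.coverMincard_le_card.trans ?_
  exact_mod_cast Finset.card_image_le.trans (Fintype.card_subtype_le _)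

variable {m K : ℕ} {c : Y → X → Fin (K + 1)}

theorem coverMincard_le_mul_pow_of_code (hφ : Function.Semiconj φ T r) (hm : 0 < m)
    (hc : ∀ b x y, (φ x, b) ∈ U → (φ y, b) ∈ U → c b x = c b y →
      (x, y) ∈ Dynamics.dynEntourage T V m) (n : ℕ) :
    Dynamics.coverMincard T Set.univ V n ≤
      Dynamics.coverMincard r Set.univ U n * ((K + 1) ^ (n / m + 1) : ℕ) := by
  rcases eq_or_ne (Dynamics.coverMincard r Set.univ U n) ⊤ with htop | htop
  · rw [htop, ENat.top_mul (by positivity)]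
    exact le_top
  obtain ⟨E, hE, hEcard⟩ :=
    (Dynamics.coverMincard_finite_iff r Set.univ U n).1 (lt_top_iff_ne_top.2 htop)
  choose b hbE hb using fun y => hE (Set.mem_univ y)
  let itinerary (x : X) : E × (Fin (n / m + 1) → Fin (K + 1)) :=
    (⟨b (φ x), hbE _⟩, fun j => c (r^[j * m] (b (φ x))) (T^[j * m] x))
  have hclose (x : X) (k : ℕ) (hk : k < n) : (φ (T^[k] x), r^[k] (b (φ x))) ∈ U := by
    rw [hφ.iterate_right k x]
    exact Dynamics.mem_dynEntourage.1 (hb (φ x)) k hk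
  have hcard := coverMincard_univ_le_card (n := n) (V := V) (T := T) itinerary fun x y hxy => by
    have hbxy : b (φ x) = b (φ y) := congrArg (fun i => (i.1 : Y)) hxy
    refine Dynamics.mem_dynEntourage.2 fun i hi => ?_
    have hblock : i / m * m < n := (Nat.div_mul_le_self i m).trans_lt hi
    have hcxy := congrFun (congrArg Prod.snd hxy)
      ⟨i / m, Nat.lt_succ_of_le (Nat.div_le_div_right hi.le)⟩
    simp only [itinerary, ← hbxy] at hcxy
    have hmem := Dynamics.mem_dynEntourage.1
      (hc _ _ _ (hclose x _ hblock) (hbxy ▸ hclose y _ hblock) hcxy) (i % m) (Nat.mod_lt i hm)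
    rwa [← Function.iterate_add_apply, ← Function.iterate_add_apply, Nat.mod_add_div'] at hmem
  refine hcard.trans_eq ?_
  rw [← hEcard]
  simp

theorem expGrowthSup_pow_div_add_one_le {P : ℕ} (hP : 0 < P) (m : ℕ) :
    ExpGrowth.expGrowthSup (fun n => ((P ^ (n / m + 1) : ℕ) : ENNReal)) ≤
      ((Real.log P / m : ℝ) : EReal) := by
  have hpow (n : ℕ) : ((P ^ (n / m) : ℕ) : ℝ) ≤ Real.exp (Real.log P / m * n) := by
    rw [Nat.cast_pow, ← Real.exp_log (Nat.cast_pos.2 hP), ← Real.exp_nat_mul, Real.log_exp,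
      Real.exp_le_exp]
    calc ((n / m : ℕ) : ℝ) * Real.log P ≤ n / m * Real.log P :=
          mul_le_mul_of_nonneg_right Nat.cast_div_le (Real.log_natCast_nonneg P)
      _ = Real.log P / m * n := by ring
  rw [← ExpGrowth.expGrowthSup_exp (a := ((Real.log P / m : ℝ) : EReal))]
  refine ExpGrowth.expGrowthSup_le_of_eventually_le (b := (P : ENNReal)) (by simp)
    (Eventually.of_forall fun n => ?_)
  have hcast : ((Real.log P / m : ℝ) : EReal) * (n : EReal) = ((Real.log P / m * n : ℝ) : EReal) :=
    by push_cast; rfl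
  rw [hcast, EReal.exp_coe, pow_succ, mul_comm, Nat.cast_mul,
    ← ENNReal.ofReal_natCast (P ^ (n / m))]
  exact mul_le_mul_right (ENNReal.ofReal_le_ofReal (hpow n)) _

theorem coverEntropyEntourage_le_add_log_div_of_code (hφ : Function.Semiconj φ T r) (hm : 0 < m)
    (hc : ∀ b x y, (φ x, b) ∈ U → (φ y, b) ∈ U → c b x = c b y →
      (x, y) ∈ Dynamics.dynEntourage T V m) :
    Dynamics.coverEntropyEntourage T Set.univ V ≤
      Dynamics.coverEntropyEntourage r Set.univ U + ((Real.log (K + 1) / m : ℝ) : EReal) := by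
  set P : ℕ → ENNReal := fun n => (((K + 1) ^ (n / m + 1) : ℕ) : ENNReal)
  have hP_le : ExpGrowth.expGrowthSup P ≤ ((Real.log (K + 1) / m : ℝ) : EReal) := by
    exact_mod_cast expGrowthSup_pow_div_add_one_le K.succ_pos m
  have hP_nonneg : 0 ≤ ExpGrowth.expGrowthSup P :=
    Frequently.le_expGrowthSup <| Frequently.of_forall fun n => by
      simpa only [zero_mul, EReal.exp_zero, P] using
        Nat.one_le_cast.2 (Nat.one_le_pow _ _ K.succ_pos)
  calc Dynamics.coverEntropyEntourage T Set.univ V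
      ≤ ExpGrowth.expGrowthSup ((fun n => (Dynamics.coverMincard r Set.univ U n : ENNReal)) * P) :=
        ExpGrowth.expGrowthSup_monotone fun n => by
          simpa only [ENat.toENNReal_mul, ENat.toENNReal_coe, Pi.mul_apply, P] using
            ENat.toENNReal_mono (coverMincard_le_mul_pow_of_code hφ hm hc n)
    _ ≤ Dynamics.coverEntropyEntourage r Set.univ U + ExpGrowth.expGrowthSup P :=
        ExpGrowth.expGrowthSup_mul_le
          (Or.inr (ne_top_of_le_ne_top (EReal.coe_ne_top _) hP_le))
          (Or.inr (ne_bot_of_le_ne_bot EReal.zero_ne_bot hP_nonneg))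
    _ ≤ _ := add_le_add_right hP_le _

end Coding

theorem tendsto_log_mul_add_one_div (N : ℕ) :
    Tendsto (fun m : ℕ => Real.log (m * N + 1) / m) atTop (𝓝 0) := by
  have hlog : Tendsto (fun m : ℕ => Real.log m / m + Real.log (N + 1) / m) atTop (𝓝 0) := by
    simpa using (Real.isLittleO_log_id_atTop.tendsto_div_nhds_zero.comp
      tendsto_natCast_atTop_atTop).add (tendsto_const_div_atTop_nhds_zero_nat _)
  refine squeeze_zero' (Eventually.of_forall fun m => ?_) ?_ hlog
  · exact div_nonneg (Real.log_nonneg (le_add_of_nonneg_left (by positivity))) m.cast_nonneg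
  · filter_upwards [eventually_gt_atTop 0] with m hm
    have hm' : (1 : ℝ) ≤ m := Nat.one_le_cast.2 hm
    rw [← add_div, ← Real.log_mul (by positivity) (by positivity)]
    gcongr
    linarith

theorem le_of_forall_le_add_log_mul_add_one_div {a b : EReal} (N : ℕ)
    (h : ∀ m : ℕ, 0 < m → a ≤ b + ((Real.log (m * N + 1) / m : ℝ) : EReal)) : a ≤ b := by
  have hlim : Tendsto (fun m : ℕ => b + ((Real.log (m * N + 1) / m : ℝ) : EReal)) atTop
      (𝓝 (b + (0 : ℝ))) :=
    (EReal.continuousAt_add (p := (b, ((0 : ℝ) : EReal))) (Or.inr (EReal.coe_ne_bot 0))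
      (Or.inr (EReal.coe_ne_top 0))).tendsto.comp (tendsto_const_nhds.prodMk_nhds
        ((continuous_coe_real_ereal.tendsto 0).comp (tendsto_log_mul_add_one_div N)))
  rw [EReal.coe_zero, add_zero] at hlim
  exact ge_of_tendsto hlim ((eventually_gt_atTop 0).mono h)

section MonotoneEntropy

variable {Θ : Type*}

theorem IsMonotoneLift.exists_fin_code_Icc [TopologicalSpace Θ] {r : Θ → Θ} {H : Θ × ℝ → ℝ}
    (hH : IsMonotoneLift H) (hr : Continuous r) {N : ℕ} (hN : 0 < N) (m : ℕ) (θ : Θ) :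
    ∃ c : Set.Icc (0 : ℝ) 1 → Fin (m * N + 1), ∀ x y, c x = c y → ∀ k < m,
      |((skewProduct r H)^[k] (θ, x)).2 - ((skewProduct r H)^[k] (θ, y)).2| < 1 / N := by
  let a (k : Fin m) (x : ℝ) : ℤ := ⌊N * ((skewProduct r H)^[k] (θ, x)).2⌋
  have ha (k : Fin m) : Monotone (a k) := fun x y hxy => Int.floor_le_floor <|
    mul_le_mul_of_nonneg_left ((hH.iterate hr k).monotone θ hxy) N.cast_nonneg
  have ha_one (k : Fin m) : a k 1 - a k 0 = N := by
    have := (hH.iterate hr k).apply_add_one θ 0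
    simp only [zero_add] at this
    simp only [a, this, mul_add, mul_one, Int.floor_add_natCast, add_sub_cancel_left]
  obtain ⟨c, hc⟩ := exists_fin_code_of_monotone ha (l := 0) (u := 1) (K := m * N) (by simp [ha_one])
  refine ⟨c, fun x y hxy k hk => ?_⟩
  have hN' : (0 : ℝ) < N := Nat.cast_pos.2 hN
  have hfloor := Int.abs_sub_lt_one_of_floor_eq_floor (hc x y hxy ⟨k, hk⟩)
  rw [← mul_sub, abs_mul, abs_of_pos hN'] at hfloor
  rwa [lt_div_iff₀' hN']

variable [UniformSpace Θ] {r : Θ → Θ} {H : Θ × ℝ → ℝ} {h : Θ × UnitAddCircle → Θ × UnitAddCircle}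

theorem IsMonotoneLift.exists_fin_code (hH : IsMonotoneLift H) (hr : Continuous r)
    (hHh : Function.Semiconj (circleProj Θ) (skewProduct r H) h)
    {W : SetRel (Θ × UnitAddCircle) (Θ × UnitAddCircle)} (hW : W ∈ uniformity _) :
    ∃ N : ℕ, ∀ m θ, ∃ c : UnitAddCircle → Fin (m * N + 1), ∀ φ ψ, c φ = c ψ →
      ((θ, φ), (θ, ψ)) ∈ Dynamics.dynEntourage h W m := by
  obtain ⟨A, hA, B, hB, hAB⟩ := entourageProd_subset hW
  obtain ⟨ε, hε, hεB⟩ := Metric.mem_uniformity_dist.1 hB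
  obtain ⟨N, hN⟩ := exists_nat_one_div_lt hε
  refine ⟨N + 1, fun m θ => ?_⟩
  obtain ⟨c, hc⟩ := hH.exists_fin_code_Icc hr N.succ_pos m θ
  have hrep (φ : UnitAddCircle) : ∃ x : Set.Icc (0 : ℝ) 1, ((x : ℝ) : UnitAddCircle) = φ :=
    ⟨⟨AddCircle.equivIco 1 0 φ, Set.Ico_subset_Icc_self <| by
      simpa only [zero_add] using (AddCircle.equivIco (1 : ℝ) 0 φ).2⟩, AddCircle.coe_equivIco⟩
  choose x hx using hrep
  refine ⟨fun φ => c (x φ), fun φ ψ hφψ => Dynamics.mem_dynEntourage.2 fun k hk => hAB ?_⟩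
  have hiterate (φ : UnitAddCircle) :
      h^[k] (θ, φ) = (r^[k] θ, (((skewProduct r H)^[k] (θ, x φ)).2 : UnitAddCircle)) := by
    rw [← skewProduct_iterate_fst r H k (θ, x φ)]
    simpa only [circleProj, hx] using (hHh.iterate_right k (θ, x φ)).symm
  rw [hiterate, hiterate]
  refine ⟨refl_mem_uniformity hA, hεB ((dist_coe_unitAddCircle_le _ _).trans_lt ?_)⟩
  exact (hc _ _ hφψ k hk).trans (by exact_mod_cast hN)

theorem IsMonotoneLift.topEntropy_le [CompactSpace Θ] (hH : IsMonotoneLift H) (hr : Continuous r)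
    (hh : Continuous h) (hHh : Function.Semiconj (circleProj Θ) (skewProduct r H) h) :
    topEntropy h ≤ topEntropy r := by
  refine iSup₂_le fun V hV => ?_
  obtain ⟨W, hW, hWsymm, hWV⟩ := comp_comp_symm_mem_uniformity_sets hV
  obtain ⟨N, hcode⟩ := hH.exists_fin_code hr hHh hW
  refine le_of_forall_le_add_log_mul_add_one_div N fun m hm => ?_
  choose c hc using hcode m
  obtain ⟨U, hU, B, hB, hUB⟩ := entourageProd_subset (Dynamics.dynEntourage_mem_uniformity
    (CompactSpace.uniformContinuous_of_continuous hh) hW m)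
  have hbase (x : Θ × UnitAddCircle) (b : Θ) (hxb : (x.1, b) ∈ U) :
      (x, (b, x.2)) ∈ Dynamics.dynEntourage h W m := hUB ⟨hxb, refl_mem_uniformity hB⟩
  have hfst : Function.Semiconj Prod.fst h r := fun q => by
    obtain ⟨p, rfl⟩ := (isOpenQuotientMap_circleProj Θ).surjective q
    rw [← hHh]
    rfl
  have hentourage := coverEntropyEntourage_le_add_log_div_of_code (U := U) (V := V)
    (c := fun b x => c b x.2) hfst hm fun b x y hxb hyb hxy =>
      Dynamics.mem_dynEntourage.2 fun k hk => hWV ⟨_, ⟨_,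
        Dynamics.mem_dynEntourage.1 (hbase x b hxb) k hk,
        Dynamics.mem_dynEntourage.1 (hc b x.2 y.2 hxy) k hk⟩,
        SetRel.symm W (Dynamics.mem_dynEntourage.1 (hbase y b hyb) k hk)⟩
  refine hentourage.trans (add_le_add (Dynamics.coverEntropyEntourage_le_coverEntropy r _ hU) ?_)
  simp

theorem topEntropy_restrict_le {X : Type*} [UniformSpace X] {f g : X → X} {M : Set X}
    (hf : Set.MapsTo f M M) (hfg : Set.EqOn f g M) :
    topEntropy (hf.restrict f M M) ≤ topEntropy g := by
  have hg : Set.MapsTo g M M := hf.congr hfg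
  have hrestrict : hf.restrict f M M = hg.restrict g M M :=
    funext fun x => Subtype.ext (hfg x.2)
  rw [hrestrict, topEntropy, Dynamics.coverEntropy_restrict hg]
  exact Dynamics.coverEntropy_monotone g (Set.subset_univ M)

end MonotoneEntropy

theorem limsup_mem_Icc_of_tendsto {ι : Type*} {l : Filter ι} [l.NeBot] {u v w : ι → ℝ} {a b : ℝ}
    (hu : Tendsto u l (𝓝 a)) (hw : Tendsto w l (𝓝 b)) (huv : u ≤ v) (hvw : v ≤ w) :
    limsup v l ∈ Set.Icc a b := by
  have hbelow : IsBoundedUnder (· ≥ ·) l v :=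
    hu.isBoundedUnder_ge.mono_ge (Eventually.of_forall huv)
  have habove : IsBoundedUnder (· ≤ ·) l v :=
    hw.isBoundedUnder_le.mono_le (Eventually.of_forall hvw)
  rw [← hu.limsup_eq, ← hw.limsup_eq]
  exact ⟨limsup_le_limsup (Eventually.of_forall huv)
      hu.isBoundedUnder_ge.isCoboundedUnder_le habove,
    limsup_le_limsup (Eventually.of_forall hvw) hbelow.isCoboundedUnder_le hw.isBoundedUnder_le⟩

theorem eqOn_iterate {X : Type*} {f g : X → X} {s : Set X} (hfg : Set.EqOn f g s)
    (hf : Set.MapsTo f s s) (n : ℕ) : Set.EqOn f^[n] g^[n] s := by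
  induction n with
  | zero => exact Set.eqOn_refl _ s
  | succ n ih =>
    intro x hx
    rw [Function.iterate_succ_apply, Function.iterate_succ_apply, ← hfg hx, ih (hf hx)]

section RotationSet

variable {Θ : Type*}

theorem IsDegreeOneLift.limsup_rotationQuotient_mem_Icc [TopologicalSpace Θ] {r : Θ → Θ}
    {G : Θ × ℝ → ℝ} (hG : IsDegreeOneLift G) {t a b : ℝ} (hGt : ∀ p, G p ≤ truncatedEnvelope G t p)
    (ha : TendstoUniformly (rotationQuotient (skewProduct r (truncatedEnvelope G 0)))
      (fun _ => a) atTop)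
    (hb : TendstoUniformly (rotationQuotient (skewProduct r (truncatedEnvelope G t)))
      (fun _ => b) atTop) (p : Θ × ℝ) :
    limsup (fun n => rotationQuotient (skewProduct r G) n p) atTop ∈ Set.Icc a b := by
  refine limsup_mem_Icc_of_tendsto (ha.tendsto_at p) (hb.tendsto_at p) (fun n => ?_) fun n => ?_ <;>
    refine div_le_div_of_nonneg_right (sub_le_sub_right ?_ _) n.cast_nonneg
  · exact (hG.isMonotoneLift_truncatedEnvelope 0).le_skewProduct_iterate_snd
      hG.truncatedEnvelope_zero_le n p
  · exact (hG.isMonotoneLift_truncatedEnvelope t).skewProduct_iterate_snd_le hGt n p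

variable [UniformSpace Θ] [CompactSpace Θ] [Nonempty Θ] {r : Θ → Θ} {G : Θ × ℝ → ℝ}
  {f : Θ × UnitAddCircle → Θ × UnitAddCircle}

theorem IsDegreeOneLift.exists_isMinimalSet_tendstoUniformlyOn (hG : IsDegreeOneLift G)
    (hr : Continuous r) (hf : Continuous f)
    (hfG : Function.Semiconj (circleProj Θ) (skewProduct r G) f) {t ρ : ℝ} (ht : 0 ≤ t)
    (hρ : TendstoUniformly (rotationQuotient (skewProduct r (truncatedEnvelope G t)))
      (fun _ => ρ) atTop) :
    ∃ (M : Set (Θ × UnitAddCircle)) (hM : IsMinimalSet f M),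
      TendstoUniformlyOn (rotationQuotient (skewProduct r G)) (fun _ => ρ) atTop
        (circleProj Θ ⁻¹' M) ∧
      topEntropy (hM.mapsTo.restrict f M M) ≤ topEntropy r := by
  have hT := hG.isMonotoneLift_truncatedEnvelope t
  obtain ⟨M, hM, hGT⟩ := hG.exists_isMinimalSet_eqOn_truncatedEnvelope hf hfG ht
  have hskew : Set.EqOn (skewProduct r G) (skewProduct r (truncatedEnvelope G t))
      (circleProj Θ ⁻¹' M) := fun p hp => Prod.ext rfl (hGT hp)
  have hinv : Set.MapsTo (skewProduct r G) (circleProj Θ ⁻¹' M) (circleProj Θ ⁻¹' M) :=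
    fun p hp => by
      rw [Set.mem_preimage, hfG]
      exact hM.mapsTo hp
  obtain ⟨h, hh, hTh⟩ := hT.exists_continuous_semiconj_circleProj hr
  have hfh : Set.EqOn f h M := fun q hq => by
    obtain ⟨p, rfl⟩ := (isOpenQuotientMap_circleProj Θ).surjective q
    rw [← hfG, ← hTh, hskew hq]
  refine ⟨M, hM, hρ.tendstoUniformlyOn.congr (Eventually.of_forall fun n p hp => ?_),
    (topEntropy_restrict_le hM.mapsTo hfh).trans (hT.topEntropy_le hr hh hTh)⟩
  simp only [rotationQuotient, eqOn_iterate hskew hinv n hp]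

end RotationSet

theorem theoremt_general {Θ : Type*} [UniformSpace Θ] [CompactSpace Θ] [T2Space Θ]
    [HasOuterApproxClosed Θ] [MeasurableSpace Θ] [BorelSpace Θ]
    (r : C(Θ, Θ)) (hr : IsUniquelyErgodic r)
    (f : C(Θ × UnitAddCircle, Θ × UnitAddCircle)) (hf : IsSkewProductOver r f)
    (hhom : IsHomotopicToId r f)
    (F : C(Θ × ℝ, Θ × ℝ)) (hF : IsLift F f) :
    (∃ a b : ℝ, a ≤ b ∧ fibredRotationSet F = Set.Icc a b) ∧
    ∀ ρ ∈ fibredRotationSet F,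
      ∃ (M : Set (Θ × UnitAddCircle)) (hM : IsMinimalSet f M),
        TendstoUniformlyOn (rotationQuotient F) (fun _ => ρ) atTop (circleProj Θ ⁻¹' M) ∧
        topEntropy (hM.mapsTo.restrict f M M) ≤ topEntropy r := by
  obtain ⟨μ, ⟨hμ, -⟩, hμ_unique⟩ := hr
  have := nonempty_of_isProbabilityMeasure μ
  let G (p : Θ × ℝ) : ℝ := (F p).2
  have hG : IsDegreeOneLift G := ⟨continuous_snd.comp F.continuous, hF.snd_apply_add_one hhom⟩
  have hFG : ⇑F = skewProduct r G := funext fun p => Prod.ext (hF.fst_apply hf p) rfl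
  obtain ⟨R, hR, hRlim⟩ := exists_continuous_rotationNumber
    hG.isMonotoneLift_truncatedEnvelope hG.continuous_truncatedEnvelope r.continuous
    fun ν hν hrν => hμ_unique ν ⟨hν, hrν⟩
  obtain ⟨t, ht, hGt⟩ := hG.exists_le_truncatedEnvelope
  have hminimal : ∀ ρ ∈ Set.Icc (R 0) (R t), ∃ (M : Set (Θ × UnitAddCircle))
      (hM : IsMinimalSet f M), TendstoUniformlyOn (rotationQuotient F) (fun _ => ρ) atTop
        (circleProj Θ ⁻¹' M) ∧ topEntropy (hM.mapsTo.restrict f M M) ≤ topEntropy r := by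
    intro ρ hρ
    obtain ⟨s, hs, rfl⟩ := intermediate_value_Icc ht hR.continuousOn hρ
    rw [hFG]
    exact hG.exists_isMinimalSet_tendstoUniformlyOn r.continuous f.continuous (hFG ▸ hF) hs.1
      (hRlim s)
  have hlimsup (p) : limsup (fun n => rotationQuotient F n p) atTop ∈ Set.Icc (R 0) (R t) :=
    hFG ▸ hG.limsup_rotationQuotient_mem_Icc hGt (hRlim 0) (hRlim t) p
  have hset : fibredRotationSet F = Set.Icc (R 0) (R t) := by
    refine (Set.range_subset_iff.2 hlimsup).antisymm fun ρ hρ => ?_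
    obtain ⟨M, hM, hunif, -⟩ := hminimal ρ hρ
    obtain ⟨p, hp⟩ := hM.nonempty.preimage (isOpenQuotientMap_circleProj Θ).surjective
    exact ⟨p, (hunif.tendsto_at hp).limsup_eq⟩
  obtain ⟨θ⟩ := ‹Nonempty Θ›
  exact ⟨⟨R 0, R t, Set.nonempty_Icc.1 ⟨_, hlimsup (θ, 0)⟩, hset⟩, fun ρ hρ =>
    hminimal ρ (hset ▸ hρ)⟩

theorem theoremt {Θ : Type*} [MetricSpace Θ] [CompactSpace Θ] [MeasurableSpace Θ] [BorelSpace Θ]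
    (r : C(Θ, Θ)) (hr : IsUniquelyErgodic r)
    (f : C(Θ × UnitAddCircle, Θ × UnitAddCircle)) (hf : IsSkewProductOver r f)
    (hhom : IsHomotopicToId r f)
    (F : C(Θ × ℝ, Θ × ℝ)) (hF : IsLift F f) :
    (∃ a b : ℝ, a ≤ b ∧ fibredRotationSet F = Set.Icc a b) ∧
    ∀ ρ ∈ fibredRotationSet F,
      ∃ (M : Set (Θ × UnitAddCircle)) (hM : IsMinimalSet f M),
        TendstoUniformlyOn (rotationQuotient F) (fun _ => ρ) Filter.atTop (circleProj Θ ⁻¹' M) ∧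
        (topEntropy r = 0 → topEntropy (hM.mapsTo.restrict f M M) = 0) := by
  obtain ⟨hIcc, hminimal⟩ := theoremt_general r hr f hf hhom F hF
  refine ⟨hIcc, fun ρ hρ => ?_⟩
  obtain ⟨M, hM, hunif, hentropy⟩ := hminimal ρ hρ
  have := hM.nonempty.to_subtype
  exact ⟨M, hM, hunif, fun hr0 =>
    (hentropy.trans_eq hr0).antisymm (Dynamics.coverEntropy_nonneg _ Set.univ_nonempty)⟩
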